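/- Consider finite matroids as first-order structures in the countable relational language $\lambda_M$ that has one $k$-ary symbol $I_k$ for every integer $k\ge 1$, where $I_k$ is interpreted as the set of $k$-tuples of distinct elements of the ground set that form an independent set. For a first-order $\lambda_M$-formula $\varphi$ with $k$ free variables and a finite matroid $M$, let $\langle\varphi,M\rangle$ be the proportion of the $k$-tuples of elements of $M$ that satisfy $\varphi$. A sequence $(M_n)_{n\in\mathbb N}$ of finite matroids is first-order convergent if $\langle\varphi,M_n\rangle$ converges for every first-order $\lambda_M$-formula $\varphi$. A limit modeling of $(M_n)$ is a $\lambda_M$-structure $\mathbf M$ such that: (i) the domain of $\mathbf M$ is a standard Borel space equipped with a probability measure $\nu$, and for every $k\ge 0$ and every first-order $\lambda_M$-formula $\varphi$ with $k$ free variables the set $\mathbf M^{\varphi}\subseteq\mathbf M^k$ of tuples satisfying $\varphi$ is measurable with respect to $\nu^k$; (ii) the relations $I_k$ of $\mathbf M$ consist of the independent $k$-tuples of distinct elements of some (possibly infinite, in the sense of Bruhn et al.) matroid on the domain of $\mathbf M$; and (iii) $\nu^k(\mathbf M^{\varphi})=\lim_{n\to\infty}\langle\varphi,M_n\rangle$ for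 every $k\ge 0$ and every first-order $\lambda_M$-formula $\varphi$ with $k$ free variables. Theorem. There exists a first-order convergent sequence of finite matroids of rank three, each representable over $\mathbb Q$, that has no limit modeling. -/

import Mathlib

open Filter Topology MeasureTheory

universe u

/-! ### Modelings, Stone pairings and first order convergence over a first order language -/

/-- The Stone pairing of a formula with `k` free variables and a finite structure: the proportion
of the `k`-tuples of elements that satisfy the formula. -/
noncomputable def finiteStonePairing {L : FirstOrder.Language} (A : Type*) [L.Structure A]
    {k : ℕ} (φ : L.Formula (Fin k)) : ℝ :=
  (Nat.card {v : Fin k → A // φ.Realize v} : ℝ) / (Nat.card A : ℝ) ^ k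

/-- A sequence of (finite) structures is first order convergent if all its Stone pairings
converge. -/
def FOConvergent (L : FirstOrder.Language) (A : ℕ → Type*) [∀ n, L.Structure (A n)] : Prop :=
  ∀ (k : ℕ) (φ : L.Formula (Fin k)), ∃ l : ℝ,
    Tendsto (fun n => finiteStonePairing (A n) φ) atTop (𝓝 l)

/-- A modeling: a structure whose domain is a standard Borel space with a probability measure `ν`
such that every subset of `A ^ k` defined by a first order formula (without parameters) is
measurable with respect to the product measure `ν ^ k`, i.e. belongs to the domain of its
completion; in particular, modelings with Borel definable sets are included. -/
structure FOModeling (L : FirstOrder.Language) where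
  carrier : Type u
  [str : L.Structure carrier]
  [measurableSpace : MeasurableSpace carrier]
  [standardBorel : StandardBorelSpace carrier]
  ν : Measure carrier
  [isProbability : IsProbabilityMeasure ν]
  measurable_definable : ∀ (k : ℕ) (φ : L.Formula (Fin k)),
    NullMeasurableSet {v : Fin k → carrier | φ.Realize v} (Measure.pi fun _ : Fin k => ν)

attribute [instance] FOModeling.str FOModeling.measurableSpace FOModeling.standardBorel
  FOModeling.isProbability

/-- The Stone pairing of a formula with `k` free variables and a modeling: the probability that a
`ν ^ k`-random `k`-tuple satisfies the formula. -/
noncomputable def FOModeling.stonePairing {L : FirstOrder.Language} (A : FOModeling.{u} L)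
    {k : ℕ} (φ : L.Formula (Fin k)) : ℝ :=
  (Measure.pi fun _ : Fin k => A.ν).real {v : Fin k → A.carrier | φ.Realize v}

/-! ### Matroids as first order structures -/

/-- The relation symbols of the language of matroids: one `k`-ary symbol for each positive `k`
(the constructor `indep k` is the symbol of arity `k + 1`). -/
inductive MatroidRel : ℕ → Type
  | indep (k : ℕ) : MatroidRel (k + 1)

/-- The language of matroids. -/
def matroidLanguage : FirstOrder.Language := ⟨fun _ => Empty, MatroidRel⟩

/-- A tuple is independent if its entries are distinct and form an independent set. -/
def Matroid.IndepTuple {α : Type*} (M : Matroid α) {k : ℕ} (v : Fin k → α) : Prop :=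
  Function.Injective v ∧ M.Indep (Set.range v)

/-- A matroid as a structure on its ground set: the `k`-ary symbol is interpreted as the set of
independent `k`-tuples. -/
instance Matroid.structureGround {α : Type*} (M : Matroid α) : matroidLanguage.Structure M.E where
  funMap := fun f => Empty.elim f
  RelMap := fun {k} (_ : MatroidRel k) v => M.IndepTuple fun i => (v i : α)

/-- The structure `A` is a (finite or infinite) matroid with ground set `A`. -/
def IsMatroidStructure (A : Type*) [matroidLanguage.Structure A] : Prop :=
  ∃ N : Matroid A, N.E = Set.univ ∧
    ∀ (k : ℕ) (v : Fin (k + 1) → A),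
      FirstOrder.Language.Structure.RelMap
        (show matroidLanguage.Relations (k + 1) from MatroidRel.indep k) v ↔ N.IndepTuple v

/-- `A` is a limit modeling of the sequence of matroids `M`: it is a matroid, and its Stone
pairings are the limits of the Stone pairings of the matroids in the sequence. -/
def FOModeling.IsMatroidLimitModeling (A : FOModeling.{u} matroidLanguage) {α : ℕ → Type*}
    (M : ∀ n, Matroid (α n)) : Prop :=
  IsMatroidStructure A.carrier ∧
    ∀ (k : ℕ) (φ : matroidLanguage.Formula (Fin k)),
      Tendsto (fun n => finiteStonePairing (M n).E φ) atTop (𝓝 (A.stonePairing φ))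

/-- A (finite) matroid is representable over `F` if its elements can be mapped to vectors over `F`
such that a set of elements is independent iff the family of its images is linearly independent
(so parallel elements may be mapped to the same vector). -/
def Matroid.IsRepresentableOver {α : Type*} (M : Matroid α) (F : Type*) [Field F] : Prop :=
  ∃ (m : ℕ) (f : α → Fin m → F), ∀ I : Set α, I ⊆ M.E → (M.Indep I ↔ LinearIndepOn F f I)

/-! ### Convergent subsequences -/

/-! The obstruction is quasirandomness. Graphs that are quasirandom of density 1/2 tend to the
constant graphon 1/2, whereas a measurable relation gives a 0/1-valued kernel. A single first-order
formula separates the two: write adjacency as a sign and average the product of the four signs over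
a random four-cycle. The average is near 0 exactly when about half of the four-cycles are even.

For a relation `R` that is null measurable for `ν²` the average is never 0
(`measureReal_evenCycle_ne_half`). If it were, writing it twice as an integral of squares would make
the sign kernel integrate to 0 over every rectangle, so `R` and its complement would carry the same
measure, which is absurd.

For the Sylvester-Hadamard graphs on N = 2^m vertices, orthogonality of the rows makes the average
of order 1/N.

These graphs are encoded in rank three over ℚ: vertices become points of the moment curve, each edge
receives a further point on its chord, and the common ratio dividing the chords is generic, so that
these points lie on no other chord (`exists_generic_ratio`). Adjacency of distinct vertices is then
definable: the line through them contains a third point (`lineAdj_graphMatroid_iff`). Each vertex is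
repeated N² times, while it is the first endpoint of at most N chord points, so chord points and
loops are a negligible fraction of the elements. Hence even four-cycles have density tending to 1/2,
also along a convergent subsequence, which compactness provides. -/

instance : Countable matroidLanguage.Symbols := by
  have h1 : Countable (Σ l, matroidLanguage.Functions l) :=
    inferInstanceAs (Countable (Σ _ : ℕ, Empty))
  have h2 : Countable (Σ l, matroidLanguage.Relations l) := by
    refine Function.Surjective.countable (α := ℕ)
      (f := fun k => (⟨k + 1, MatroidRel.indep k⟩ : Σ l, MatroidRel l)) ?_
    rintro ⟨_, ⟨k⟩⟩
    exact ⟨k, rfl⟩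
  exact inferInstanceAs (Countable ((Σ l, matroidLanguage.Functions l) ⊕ _))

theorem finiteStonePairing_mem_Icc {L : FirstOrder.Language} (A : Type*) [L.Structure A]
    [Finite A] {k : ℕ} (φ : L.Formula (Fin k)) : finiteStonePairing A φ ∈ Set.Icc (0 : ℝ) 1 := by
  refine ⟨by unfold finiteStonePairing; positivity, div_le_one_of_le₀ ?_ (by positivity)⟩
  have h : Nat.card {v : Fin k → A // φ.Realize v} ≤ Nat.card (Fin k → A) :=
    Nat.card_le_card_of_injective _ Subtype.val_injective
  have h' : Nat.card (Fin k → A) = Nat.card A ^ k := by simp [Nat.card_fun]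
  rw [h'] at h
  exact_mod_cast h

/-- Every sequence of finite structures over a countable language has a first order convergent
subsequence. -/
theorem exists_foConvergent_subseq {L : FirstOrder.Language} [Countable L.Symbols] (A : ℕ → Type*)
    [∀ n, L.Structure (A n)] [∀ n, Finite (A n)] :
    ∃ s : ℕ → ℕ, StrictMono s ∧ FOConvergent L (fun n => A (s n)) := by
  -- All Stone pairings together form a point of a power of [0,1]. There are only countably many
  -- formulas, so this power is first countable and compactness yields a convergent subsequence.
  let x : ℕ → ((p : Σ k : ℕ, L.Formula (Fin k)) → Set.Icc (0 : ℝ) 1) :=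
    fun n p => ⟨finiteStonePairing (A n) p.2, finiteStonePairing_mem_Icc _ _⟩
  obtain ⟨a, -, s, hs, ha⟩ := isCompact_univ.tendsto_subseq (x := x) fun _ => Set.mem_univ _
  refine ⟨s, hs, fun k φ => ⟨a ⟨k, φ⟩, ?_⟩⟩
  exact (continuous_subtype_val.tendsto _).comp ((tendsto_pi_nhds.1 ha) ⟨k, φ⟩)

/-! ### Sign kernels -/

open Classical in
/-- The sign of a proposition. -/
noncomputable def propSign (p : Prop) : ℝ := if p then 1 else -1

theorem abs_propSign (p : Prop) : |propSign p| = 1 := by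
  by_cases p <;> simp_all [propSign]

theorem propSign_iff (p q : Prop) : propSign (p ↔ q) = propSign p * propSign q := by
  by_cases p <;> by_cases q <;> simp_all [propSign]

/-- The four-cycle `x₀ x₂`, `x₁ x₂`, `x₀ x₃`, `x₁ x₃` has an even number of related pairs. -/
def EvenCycle {A : Type*} (R : A → A → Prop) (v : Fin 4 → A) : Prop :=
  (R (v 0) (v 2) ↔ R (v 1) (v 2)) ↔ (R (v 0) (v 3) ↔ R (v 1) (v 3))

theorem propSign_evenCycle {A : Type*} (R : A → A → Prop) (v : Fin 4 → A) :
    propSign (EvenCycle R v) = (propSign (R (v 0) (v 2)) * propSign (R (v 1) (v 2))) *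
      (propSign (R (v 0) (v 3)) * propSign (R (v 1) (v 3))) := by
  simp only [EvenCycle, propSign_iff]

section Kernel

variable {A : Type*} [MeasurableSpace A] {ν : Measure A} [IsProbabilityMeasure ν]

theorem measurable_propSign {B : Type*} [MeasurableSpace B] {p : B → Prop}
    (hp : MeasurableSet {x | p x}) : Measurable fun x => propSign (p x) := by
  classical
  exact Measurable.ite hp measurable_const measurable_const

theorem integrable_of_abs_le {B : Type*} [MeasurableSpace B] {μ : Measure B} [IsFiniteMeasure μ]
    {f : B → ℝ} (hf : Measurable f) (C : ℝ) (h : ∀ x, |f x| ≤ C) : Integrable f μ :=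
  Integrable.of_bound hf.aestronglyMeasurable C (ae_of_all _ h)

theorem integral_propSign {B : Type*} [MeasurableSpace B] {μ : Measure B} [IsProbabilityMeasure μ]
    {p : B → Prop} (hp : MeasurableSet {x | p x}) :
    ∫ x, propSign (p x) ∂μ = 2 * μ.real {x | p x} - 1 := by
  have h : ∀ x, propSign (p x) = 2 * {x | p x}.indicator (fun _ => (1 : ℝ)) x - 1 := by
    intro x
    by_cases h : p x <;> (simp [propSign, h]; try norm_num)
  simp_rw [h]
  rw [integral_sub, integral_const_mul, integral_indicator hp]
  · simp
  · exact ((integrable_const _).indicator hp).const_mul _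
  · exact integrable_const _

theorem measurable_kernel_comp {A : Type*} [MeasurableSpace A] {g : A → A → ℝ} (hg : Measurable (Function.uncurry g))
    {B : Type*} [MeasurableSpace B] {s t : B → A} (hs : Measurable s) (ht : Measurable t) :
    Measurable fun b => g (s b) (t b) :=
  hg.comp (hs.prodMk ht)

/-- Once the first pair of vertices is fixed, the two others are independent, so the four-cycle
integral is the integral of the square of this inner product. -/
theorem ae_inner_eq_zero {g : A → A → ℝ} (hg : Measurable (Function.uncurry g))
    (hb : ∀ x y, |g x y| ≤ 1)
    (h : ∫ p : (A × A) × (A × A), (g p.1.1 p.2.1 * g p.1.2 p.2.1) * (g p.1.1 p.2.2 * g p.1.2 p.2.2)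
      ∂((ν.prod ν).prod (ν.prod ν)) = 0) :
    ∀ᵐ p ∂(ν.prod ν), ∫ y, g p.1 y * g p.2 y ∂ν = 0 := by
  have hb2 : ∀ x x' y, |g x y * g x' y| ≤ 1 := fun x x' y => by
    rw [abs_mul]; exact mul_le_one₀ (hb _ _) (abs_nonneg _) (hb _ _)
  have hG : Measurable fun q : (A × A) × A => g q.1.1 q.2 * g q.1.2 q.2 :=
    (measurable_kernel_comp hg (by fun_prop) (by fun_prop)).mul
      (measurable_kernel_comp hg (by fun_prop) (by fun_prop))
  rw [integral_prod] at h
  · have h2 : ∀ p : A × A, ∫ q : A × A, (g p.1 q.1 * g p.2 q.1) * (g p.1 q.2 * g p.2 q.2)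
        ∂(ν.prod ν) = (∫ y, g p.1 y * g p.2 y ∂ν) ^ 2 := fun p => by
      rw [integral_prod_mul (fun y => g p.1 y * g p.2 y) (fun y => g p.1 y * g p.2 y), sq]
    simp only [h2] at h
    rw [integral_eq_zero_iff_of_nonneg (fun _ => sq_nonneg _)] at h
    · filter_upwards [h] with p hp
      simpa using hp
    · have hm : Measurable fun p : A × A => ∫ y, g p.1 y * g p.2 y ∂ν :=
        (hG.stronglyMeasurable.integral_prod_right' (ν := ν)).measurable
      refine integrable_of_abs_le (hm.pow_const 2) 1 fun p => ?_
      have : |∫ y, g p.1 y * g p.2 y ∂ν| ≤ 1 := by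
        simpa using norm_integral_le_of_norm_le_const (μ := ν) (C := 1)
          (f := fun y => g p.1 y * g p.2 y) (ae_of_all _ fun y => hb2 p.1 p.2 y)
      rw [abs_pow]
      exact pow_le_one₀ (abs_nonneg _) this
  · refine integrable_of_abs_le ?_ 1 fun p => ?_
    · exact (hG.comp (by fun_prop : Measurable fun p : (A × A) × (A × A) => (p.1, p.2.1))).mul
        (hG.comp (by fun_prop : Measurable fun p : (A × A) × (A × A) => (p.1, p.2.2)))
    · rw [abs_mul]
      exact mul_le_one₀ (hb2 _ _ _) (abs_nonneg _) (hb2 _ _ _)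

/-- A second use of squares: the integral over y of (∫_S g(x,y) dx)² unfolds to the integral over S
× S of the inner products, which vanish almost everywhere. So ∫_S g(x,y) dx = 0 for almost every y,
and it remains to integrate over `T`. -/
theorem setIntegral_rectangle_eq_zero {g : A → A → ℝ} (hg : Measurable (Function.uncurry g))
    (hb : ∀ x y, |g x y| ≤ 1) (h : ∀ᵐ p ∂(ν.prod ν), ∫ y, g p.1 y * g p.2 y ∂ν = 0) (S T : Set A) :
    ∫ p in S ×ˢ T, g p.1 p.2 ∂(ν.prod ν) = 0 := by
  let σ := ν.restrict S
  have hσ : (σ.prod σ) ≪ ν.prod ν := Measure.AbsolutelyContinuous.prod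
    Measure.restrict_le_self.absolutelyContinuous Measure.restrict_le_self.absolutelyContinuous
  have hb2 : ∀ x x' y, |g x y * g x' y| ≤ 1 := fun x x' y => by
    rw [abs_mul]; exact mul_le_one₀ (hb _ _) (abs_nonneg _) (hb _ _)
  have hG : Measurable fun q : (A × A) × A => g q.1.1 q.2 * g q.1.2 q.2 :=
    (measurable_kernel_comp hg (by fun_prop) (by fun_prop)).mul
      (measurable_kernel_comp hg (by fun_prop) (by fun_prop))
  have h1 : ∫ y, (∫ x, g x y ∂σ) ^ 2 ∂ν = 0 := by
    have h2 : ∀ y, (∫ x, g x y ∂σ) ^ 2 = ∫ p : A × A, g p.1 y * g p.2 y ∂(σ.prod σ) := fun y => by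
      rw [sq, ← integral_prod_mul]
    simp_rw [h2]
    rw [integral_integral_swap]
    · rw [integral_eq_zero_of_ae]
      filter_upwards [hσ.ae_le h] with p hp using hp
    · exact integrable_of_abs_le (hG.comp measurable_swap) 1 fun p => hb2 _ _ _
  have hm : Measurable fun y => ∫ x, g x y ∂σ :=
    (hg.stronglyMeasurable.integral_prod_left' (μ := σ)).measurable
  rw [integral_eq_zero_iff_of_nonneg (fun _ => sq_nonneg _)] at h1
  · rw [← Measure.prod_restrict, integral_prod_symm]
    · refine integral_eq_zero_of_ae ?_
      filter_upwards [ae_restrict_of_ae h1] with y hy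
      simpa using hy
    · exact integrable_of_abs_le hg 1 fun p => hb _ _
  · refine integrable_of_abs_le (hm.pow_const 2) 1 fun y => ?_
    have : |∫ x, g x y ∂σ| ≤ 1 * σ.real Set.univ :=
      norm_integral_le_of_norm_le_const (μ := σ) (C := 1) (f := fun x => g x y)
        (ae_of_all _ fun x => hb x y)
    have h3 : σ.real Set.univ ≤ 1 := by
      rw [measureReal_restrict_apply MeasurableSet.univ]; exact measureReal_le_one
    rw [abs_pow]
    exact pow_le_one₀ (abs_nonneg _) (by linarith)

/-- A measurable relation is never quasirandom of density one half. -/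
theorem integral_cycle_propSign_ne_zero {R : A → A → Prop}
    (hR : MeasurableSet {p : A × A | R p.1 p.2}) :
    ∫ p : (A × A) × (A × A), (propSign (R p.1.1 p.2.1) * propSign (R p.1.2 p.2.1)) *
      (propSign (R p.1.1 p.2.2) * propSign (R p.1.2 p.2.2))
      ∂((ν.prod ν).prod (ν.prod ν)) ≠ 0 := by
  intro h
  have hg : Measurable (Function.uncurry fun x y => propSign (R x y)) := measurable_propSign hR
  have hb : ∀ x y, |propSign (R x y)| ≤ 1 := fun x y => (abs_propSign _).le
  have hrect := setIntegral_rectangle_eq_zero hg hb (ae_inner_eq_zero hg hb h)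
  let G := {p : A × A | R p.1 p.2}
  -- Vanishing on rectangles says that the relation and its complement fill equal parts of each
  -- rectangle. Rectangles determine a finite measure on the product, and evaluating the equality at
  -- `G` and at `Gᶜ` makes both null.
  have key : (ν.prod ν).restrict G = (ν.prod ν).restrict Gᶜ := by
    refine Measure.ext_prod fun {S T} hS hT => ?_
    have h1 := hrect S T
    rw [← integral_add_compl hR] at h1
    · rw [Measure.restrict_restrict hR, Measure.restrict_restrict hR.compl,
        setIntegral_congr_fun (g := fun _ => (1 : ℝ)) (hR.inter (hS.prod hT)),
        setIntegral_congr_fun (g := fun _ => (-1 : ℝ)) (hR.compl.inter (hS.prod hT))] at h1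
      · rw [Measure.restrict_apply (hS.prod hT), Measure.restrict_apply (hS.prod hT),
          Set.inter_comm, Set.inter_comm _ Gᶜ,
          ← ENNReal.toReal_eq_toReal_iff' (measure_ne_top _ _) (measure_ne_top _ _)]
        simp [Measure.real] at h1
        change (ν.prod ν (G ∩ _)).toReal + - (ν.prod ν (Gᶜ ∩ _)).toReal = 0 at h1
        linarith
      · intro p hp
        have : ¬ R p.1 p.2 := hp.1
        simp [propSign, this]
      · intro p hp
        have : R p.1 p.2 := hp.1
        simp [propSign, this]
    · exact integrable_of_abs_le hg 1 fun p => hb _ _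
  have h1 := congrArg (fun μ => μ G) key
  have h2 := congrArg (fun μ => μ Gᶜ) key
  have hG : MeasurableSet G := hR
  simp only [Measure.restrict_apply hG, Measure.restrict_apply hG.compl, Set.inter_self,
    Set.inter_compl_self, Set.compl_inter_self, measure_empty] at h1 h2
  have h3 := measure_add_measure_compl (μ := ν.prod ν) hR
  change ν.prod ν G + ν.prod ν Gᶜ = _ at h3
  rw [h1, ← h2] at h3
  simp at h3

theorem measurePreserving_pair_pi {ι : Type*} [Fintype ι] {i j : ι} (hij : i ≠ j) :
    MeasurePreserving (fun v : ι → A => (v i, v j)) (Measure.pi fun _ => ν) (ν.prod ν) := by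
  have hI := ProbabilityTheory.iIndepFun_pi (μ := fun _ : ι => ν) (X := fun _ x => x)
    (fun _ => aemeasurable_id)
  refine ⟨by fun_prop, ?_⟩
  rw [(ProbabilityTheory.indepFun_iff_map_prod_eq_prod_map_map
    (measurable_pi_apply i).aemeasurable (measurable_pi_apply j).aemeasurable).1
    (hI.indepFun hij)]
  rw [(measurePreserving_eval (fun _ : ι => ν) i).map_eq,
    (measurePreserving_eval (fun _ : ι => ν) j).map_eq]

theorem measurePreserving_pairs_pi :
    MeasurePreserving (fun v : Fin 4 → A => ((v 0, v 1), (v 2, v 3))) (Measure.pi fun _ => ν)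
      ((ν.prod ν).prod (ν.prod ν)) := by
  have hI := ProbabilityTheory.iIndepFun_pi (μ := fun _ : Fin 4 => ν) (X := fun _ x => x)
    (fun _ => aemeasurable_id)
  refine ⟨by fun_prop, ?_⟩
  rw [(ProbabilityTheory.indepFun_iff_map_prod_eq_prod_map_map (by fun_prop) (by fun_prop)).1
    (hI.indepFun_prodMk_prodMk (fun i => by fun_prop) 0 1 2 3 (by decide) (by decide) (by decide)
      (by decide))]
  rw [(measurePreserving_pair_pi (ν := ν) (by decide : (0 : Fin 4) ≠ 1)).map_eq,
    (measurePreserving_pair_pi (ν := ν) (by decide : (2 : Fin 4) ≠ 3)).map_eq]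

/-- A null measurable relation cannot have exactly half of the four-cycles even. -/
theorem measureReal_evenCycle_ne_half {R : A → A → Prop}
    (hR : NullMeasurableSet {v : Fin 2 → A | R (v 0) (v 1)} (Measure.pi fun _ => ν)) :
    (Measure.pi fun _ : Fin 4 => ν).real {v | EvenCycle R v} ≠ 1 / 2 := by
  intro h
  have hR' : NullMeasurableSet {p : A × A | R p.1 p.2} (ν.prod ν) := by
    have := hR.preimage
      (measurePreserving_finTwoArrow ν).symm.quasiMeasurePreserving
    exact this
  -- `R` is only null measurable, so it is replaced by a measurable hull. Any two distinct
  -- coordinates of a random quadruple have law `ν.prod ν`, so almost surely no edge of the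
  -- four-cycle changes.
  let G := toMeasurable (ν.prod ν) {p : A × A | R p.1 p.2}
  have hG : MeasurableSet G := measurableSet_toMeasurable _ _
  let Q : A → A → Prop := fun x y => (x, y) ∈ G
  have hQ : MeasurableSet {p : A × A | Q p.1 p.2} := hG
  have hQR : ∀ᵐ p ∂(ν.prod ν), Q p.1 p.2 ↔ R p.1 p.2 := by
    filter_upwards [hR'.toMeasurable_ae_eq] with p hp
    exact iff_of_eq hp
  have hpair : ∀ i j : Fin 4, i ≠ j →
      ∀ᵐ v ∂(Measure.pi fun _ : Fin 4 => ν), Q (v i) (v j) ↔ R (v i) (v j) := fun i j hij =>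
    (measurePreserving_pair_pi (ν := ν) hij).quasiMeasurePreserving.ae hQR
  have hae : {v | EvenCycle R v} =ᵐ[Measure.pi fun _ : Fin 4 => ν] {v | EvenCycle Q v} := by
    filter_upwards [hpair 0 2 (by decide), hpair 1 2 (by decide), hpair 0 3 (by decide),
      hpair 1 3 (by decide)] with v h1 h2 h3 h4
    refine propext ?_
    change EvenCycle R v ↔ EvenCycle Q v
    simp only [EvenCycle, h1, h2, h3, h4]
  rw [measureReal_congr hae] at h
  have hm : ∀ i j : Fin 4, MeasurableSet {v : Fin 4 → A | Q (v i) (v j)} := fun i j =>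
    hG.preimage (by fun_prop : Measurable fun v : Fin 4 → A => (v i, v j))
  have hC : MeasurableSet {v : Fin 4 → A | EvenCycle Q v} :=
    ((hm 0 2).iff (hm 1 2)).iff ((hm 0 3).iff (hm 1 3))
  have h1 := integral_propSign (μ := Measure.pi fun _ : Fin 4 => ν) hC
  rw [h] at h1
  refine integral_cycle_propSign_ne_zero (ν := ν) hQ ?_
  rw [← (measurePreserving_pairs_pi (ν := ν)).map_eq, integral_map]
  · simp_rw [propSign_evenCycle] at h1
    rw [h1]; norm_num
  · fun_prop
  · have hs := measurable_propSign hQ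
    refine Measurable.aestronglyMeasurable ?_
    exact ((hs.comp (by fun_prop : Measurable fun p : (A × A) × A × A => (p.1.1, p.2.1))).mul
      (hs.comp (by fun_prop : Measurable fun p : (A × A) × A × A => (p.1.2, p.2.1)))).mul
      ((hs.comp (by fun_prop : Measurable fun p : (A × A) × A × A => (p.1.1, p.2.2))).mul
      (hs.comp (by fun_prop : Measurable fun p : (A × A) × A × A => (p.1.2, p.2.2))))

end Kernel

/-! ### The adjacency formula -/

section Formula

open FirstOrder FirstOrder.Language FirstOrder.Language.Structure

/-- The binary symbol of the language of matroids. -/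
def indepPairSymbol : matroidLanguage.Relations 2 := MatroidRel.indep 1

/-- The ternary symbol of the language of matroids. -/
def indepTripleSymbol : matroidLanguage.Relations 3 := MatroidRel.indep 2

/-- Two elements are adjacent if they are independent and the line through them contains an element
that is parallel to neither of them. -/
def LineAdj (A : Type*) [matroidLanguage.Structure A] (x y : A) : Prop :=
  RelMap indepPairSymbol ![x, y] ∧
    ∃ z, RelMap indepPairSymbol ![x, z] ∧ RelMap indepPairSymbol ![y, z] ∧
      ¬ RelMap indepTripleSymbol ![x, y, z]

/-- The formula defining adjacency. -/
def lineAdjFormula {ι : Type} (i j : ι) : matroidLanguage.Formula ι :=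
  indepPairSymbol.formula₂ (Term.var i) (Term.var j) ⊓
    BoundedFormula.ex (n := 0)
      (indepPairSymbol.boundedFormula₂ (Term.var (Sum.inl i)) (Term.var (Sum.inr 0)) ⊓
        (indepPairSymbol.boundedFormula₂ (Term.var (Sum.inl j)) (Term.var (Sum.inr 0)) ⊓
          (indepTripleSymbol.boundedFormula ![Term.var (Sum.inl i), Term.var (Sum.inl j),
            Term.var (Sum.inr 0)]).not))

theorem realize_lineAdjFormula {ι : Type} (i j : ι) {A : Type*} [matroidLanguage.Structure A]
    (v : ι → A) : (lineAdjFormula i j).Realize v ↔ LineAdj A (v i) (v j) := by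
  rw [lineAdjFormula, Formula.realize_inf, LineAdj, Formula.realize_rel₂]
  refine and_congr Iff.rfl ?_
  rw [Formula.Realize, BoundedFormula.realize_ex]
  refine exists_congr fun z => ?_
  rw [BoundedFormula.realize_inf, BoundedFormula.realize_inf, BoundedFormula.realize_not,
    BoundedFormula.realize_rel₂, BoundedFormula.realize_rel₂, BoundedFormula.realize_rel]
  have h : (fun k : Fin 3 => ((![Term.var (Sum.inl i), Term.var (Sum.inl j), Term.var (Sum.inr 0)]
      k : matroidLanguage.Term (ι ⊕ Fin 1)).realize
        (Sum.elim v (Fin.snoc default z : Fin 1 → A)))) = ![v i, v j, z] := by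
    funext k
    fin_cases k <;> rfl
  rw [h]
  rfl

/-- The formula stating that a four-cycle has an even number of adjacent pairs. -/
def evenCycleFormula : matroidLanguage.Formula (Fin 4) :=
  ((lineAdjFormula 0 2).iff (lineAdjFormula 1 2)).iff
    ((lineAdjFormula 0 3).iff (lineAdjFormula 1 3))

theorem realize_evenCycleFormula {A : Type*} [matroidLanguage.Structure A] (v : Fin 4 → A) :
    evenCycleFormula.Realize v ↔ EvenCycle (LineAdj A) v := by
  simp only [evenCycleFormula, Formula.realize_iff, realize_lineAdjFormula, EvenCycle]

/-- Adjacency is itself definable by a formula in two variables, so the measurability axiom of a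
modeling applies to it. -/
theorem FOModeling.stonePairing_evenCycleFormula_ne_half (A : FOModeling.{u} matroidLanguage) :
    A.stonePairing evenCycleFormula ≠ 1 / 2 := by
  have h := A.measurable_definable 2 (lineAdjFormula 0 1)
  simp only [realize_lineAdjFormula] at h
  simpa only [FOModeling.stonePairing, realize_evenCycleFormula] using
    measureReal_evenCycle_ne_half h

end Formula

/-! ### Matroids of vector configurations -/

section VectorMatroid

variable {α F W : Type*} [Field F] [AddCommGroup W] [Module F W]

/-- If no element of `J` outside `I` extended `I`, the span of `f '' J` would lie in that of `f ''
I`, and comparing dimensions would contradict the cardinalities. -/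
theorem LinearIndepOn.exists_insert_of_ncard_lt {f : α → W} {I J : Set α}
    (hI : LinearIndepOn F f I) (hIf : I.Finite) (hJ : LinearIndepOn F f J) (hJf : J.Finite)
    (hIJ : I.ncard < J.ncard) : ∃ e ∈ J, e ∉ I ∧ LinearIndepOn F f (insert e I) := by
  by_contra! hcon
  have hfin := hIf.fintype
  have hfinJ := hJf.fintype
  have hspan : Submodule.span F (f '' J) ≤ Submodule.span F (f '' I) := by
    rw [Submodule.span_le]
    rintro _ ⟨e, he, rfl⟩
    by_cases heI : e ∈ I
    · exact Submodule.subset_span ⟨e, heI, rfl⟩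
    · by_contra hne
      exact hcon e he heI (hI.insert hne)
  have : FiniteDimensional F (Submodule.span F (f '' I)) :=
    FiniteDimensional.span_of_finite F (hIf.image f)
  have h := Submodule.finrank_mono hspan
  have hc : ∀ (K : Set α) [Fintype K], LinearIndepOn F f K →
      Module.finrank F (Submodule.span F (f '' K)) = K.ncard := by
    intro K _ hK
    have h1 := finrank_span_eq_card hK
    rw [← Set.image_eq_range] at h1
    rw [h1, ← Nat.card_eq_fintype_card, Nat.card_coe_set_eq]
  rw [hc I hI, hc J hJ] at h
  omega

/-- The matroid of linear independence of a finite family of vectors. -/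
noncomputable def Matroid.ofVectors (F : Type*) [Field F] [Module F W] [Finite α] (f : α → W) :
    Matroid α :=
  (IndepMatroid.ofFinitaryCardAugment Set.univ (LinearIndepOn F f) (linearIndepOn_empty F f)
    (fun _ _ hJ hIJ => hJ.mono hIJ)
    (fun _ _ hI hIf hJ hJf h => hI.exists_insert_of_ncard_lt hIf hJ hJf h)
    (fun I h => h I subset_rfl I.toFinite) (fun _ _ => Set.subset_univ _)).matroid

variable [Finite α] (f : α → W)

theorem Matroid.ofVectors_indepTuple {k : ℕ} (v : Fin k → α) :
    (Matroid.ofVectors F f).IndepTuple v ↔ LinearIndependent F (f ∘ v) := by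
  refine ⟨fun ⟨hv, h⟩ => (linearIndepOn_range_iff hv f).1 h, fun h => ?_⟩
  have hv : Function.Injective v := h.injective.of_comp
  exact ⟨hv, (linearIndepOn_range_iff hv f).2 h⟩

theorem Matroid.ofVectors_eRank_eq [FiniteDimensional F W] {k : ℕ} (hk : Module.finrank F W = k)
    (v : Fin k → α) (hv : LinearIndependent F (f ∘ v)) : (Matroid.ofVectors F f).eRank = k := by
  apply le_antisymm
  · obtain ⟨B, hB⟩ := (Matroid.ofVectors F f).exists_isBase
    have hB' : LinearIndepOn F f B := hB.indep
    have := Fintype.ofFinite B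
    rw [← hB.encard_eq_eRank, ← B.toFinite.cast_ncard_eq, ← hk, ← Nat.card_coe_set_eq,
      Nat.card_eq_fintype_card]
    exact_mod_cast hB'.fintype_card_le_finrank
  · have h := (Matroid.ofVectors_indepTuple (F := F) f v).2 hv
    have h2 := h.2.encard_le_eRank
    rw [← Set.image_univ, h.1.encard_image, Set.encard_univ] at h2
    simpa using h2

end VectorMatroid

/-! ### Points in general position and points on the lines joining them -/

section Plane

/-- The points of the moment curve in the projective plane. -/
def momentPoint (t : ℚ) : Fin 3 → ℚ := ![1, t, t ^ 2]

theorem linearIndependent_triple_iff (a b c : Fin 3 → ℚ) :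
    LinearIndependent ℚ ![a, b, c] ↔ (Matrix.of ![a, b, c]).det ≠ 0 := by
  rw [← isUnit_iff_ne_zero, ← Matrix.isUnit_iff_isUnit_det,
    ← Matrix.linearIndependent_rows_iff_isUnit]
  rfl

theorem linearIndependent_momentPoint_iff (x y z : ℚ) :
    LinearIndependent ℚ ![momentPoint x, momentPoint y, momentPoint z] ↔
      (y - x) * (z - x) * (z - y) ≠ 0 := by
  rw [linearIndependent_triple_iff, Matrix.det_fin_three]
  refine not_congr ?_
  simp only [momentPoint, Matrix.of_apply, Matrix.cons_val]
  ring_nf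

/-- Expanding the determinant along its third row gives a combination of two Vandermonde
determinants. For fixed points its vanishing is an equation of degree at most one in `c`, which is
what makes a generic ratio available. -/
theorem linearIndependent_momentPoint_add_iff (x y z w c : ℚ) :
    LinearIndependent ℚ ![momentPoint x, momentPoint y, momentPoint z + c • momentPoint w] ↔
      (y - x) * ((z - x) * (z - y) + c * ((w - x) * (w - y))) ≠ 0 := by
  rw [linearIndependent_triple_iff, Matrix.det_fin_three]
  refine not_congr ?_
  simp only [momentPoint, Matrix.of_apply, Matrix.cons_val, Pi.add_apply, Pi.smul_apply,
    smul_eq_mul]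
  ring_nf

theorem linearIndependent_momentPoint_pair_iff {x y : ℚ} :
    LinearIndependent ℚ ![momentPoint x, momentPoint y] ↔ x ≠ y := by
  constructor
  · rintro h rfl
    exact absurd (h.injective (a₁ := 0) (a₂ := 1) rfl) (by decide)
  · intro h
    rw [LinearIndependent.pair_iff]
    intro s t hst
    have h0 := congrFun hst 0
    have h1 := congrFun hst 1
    simp [momentPoint] at h0 h1
    have : t * (y - x) = 0 := by linear_combination h1 - x * h0
    have ht : t = 0 := (mul_eq_zero.1 this).resolve_right (sub_ne_zero.2 h.symm)
    exact ⟨by linarith, ht⟩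

theorem linearIndependent_momentPoint_left {x y c : ℚ} (h : x ≠ y) (hc : c ≠ 0) :
    LinearIndependent ℚ ![momentPoint x, momentPoint x + c • momentPoint y] := by
  have hp := LinearIndependent.pair_iff.1 (linearIndependent_momentPoint_pair_iff.2 h)
  rw [LinearIndependent.pair_iff]
  intro s t hst
  obtain ⟨h1, h2⟩ := hp (s + t) (t * c) (by rw [← hst]; module)
  have ht : t = 0 := (mul_eq_zero.1 h2).resolve_right hc
  exact ⟨by linarith, ht⟩

theorem linearIndependent_momentPoint_right {x y c : ℚ} (h : x ≠ y) :
    LinearIndependent ℚ ![momentPoint y, momentPoint x + c • momentPoint y] := by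
  have hp := LinearIndependent.pair_iff.1 (linearIndependent_momentPoint_pair_iff.2 h)
  rw [LinearIndependent.pair_iff]
  intro s t hst
  obtain ⟨h1, h2⟩ := hp t (s + t * c) (by rw [← hst]; module)
  exact ⟨by simpa [h1] using h2, h1⟩

/-- For finitely many points of the moment curve, the points dividing the chords in a suitable
common ratio lie on no other chord. -/
theorem exists_generic_ratio {V : Type*} [Finite V] (τ : V → ℚ) (hτ : Function.Injective τ) :
    ∃ c : ℚ, c ≠ 0 ∧ ∀ i k l j : V, i ≠ k → l ≠ j →
      (τ l - τ i) * (τ l - τ k) + c * ((τ j - τ i) * (τ j - τ k)) = 0 →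
      (l = i ∧ j = k) ∨ (l = k ∧ j = i) := by
  let bad : V × V × V × V → ℚ := fun q =>
    -((τ q.2.2.1 - τ q.1) * (τ q.2.2.1 - τ q.2.1)) /
      ((τ q.2.2.2 - τ q.1) * (τ q.2.2.2 - τ q.2.1))
  obtain ⟨c, hc⟩ := ((Set.finite_range bad).union (Set.finite_singleton 0)).infinite_compl.nonempty
  simp only [Set.mem_compl_iff, Set.mem_union, Set.mem_range, Set.mem_singleton_iff, not_or,
    not_exists] at hc
  refine ⟨c, hc.2, fun i k l j hik hlj h => ?_⟩
  -- A zero coefficient of `c` puts `j`, and then also `l`, in {i, k}, and these are distinct.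
  -- Otherwise the equation determines `c` as one of the finitely many excluded values.
  by_cases hj : (τ j - τ i) * (τ j - τ k) = 0
  · rw [hj, mul_zero, add_zero] at h
    simp only [mul_eq_zero, sub_eq_zero, hτ.eq_iff] at h hj
    grind
  · refine absurd ?_ (hc.1 (i, k, l, j))
    simp only [bad]
    rw [div_eq_iff hj]
    linarith

end Plane

/-! ### The matroid of a graph -/

section GraphMatroid

variable {V : Type} (ad : V → V → Prop) (τ : V → ℚ) (c : ℚ)

open Classical in
/-- The vectors representing a graph: many copies of each vertex, placed on the moment curve, and a
point on the chord of each edge (and zero vectors for the remaining pairs of vertices). -/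
noncomputable def graphVector : V × ((V × V) ⊕ V) → Fin 3 → ℚ
  | (i, Sum.inl _) => momentPoint (τ i)
  | (i, Sum.inr j) => if i ≠ j ∧ ad i j then momentPoint (τ i) + c • momentPoint (τ j) else 0

variable [Finite V]

/-- The matroid representing a graph. -/
noncomputable def graphMatroid : Matroid (V × ((V × V) ⊕ V)) :=
  Matroid.ofVectors ℚ (graphVector ad τ c)

theorem graphMatroid_mem_ground (a : V × ((V × V) ⊕ V)) : a ∈ (graphMatroid ad τ c).E :=
  Set.mem_univ a

open FirstOrder.Language.Structure in
theorem relMap_indepPairSymbol (a b : (graphMatroid ad τ c).E) :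
    RelMap indepPairSymbol ![a, b] ↔
      LinearIndependent ℚ ![graphVector ad τ c a, graphVector ad τ c b] := by
  refine (Matroid.ofVectors_indepTuple (F := ℚ) (graphVector ad τ c) _).trans (iff_of_eq ?_)
  congr 1
  funext i
  fin_cases i <;> rfl

open FirstOrder.Language.Structure in
theorem relMap_indepTripleSymbol (a b d : (graphMatroid ad τ c).E) :
    RelMap indepTripleSymbol ![a, b, d] ↔
      LinearIndependent ℚ ![graphVector ad τ c a, graphVector ad τ c b, graphVector ad τ c d] := by
  refine (Matroid.ofVectors_indepTuple (F := ℚ) (graphVector ad τ c) _).trans (iff_of_eq ?_)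
  congr 1
  funext i
  fin_cases i <;> rfl

variable {ad τ c}

/-- A third element on the line of `i` and `k` cannot be a vertex copy, since three distinct points
of the moment curve are independent and a copy of `i` or `k` is parallel to one of them. It cannot
be a zero vector, which is a loop. So it divides a chord, and genericity identifies that chord with
the one joining `i` and `k`. -/
theorem lineAdj_graphMatroid_iff (hsymm : ∀ i j, ad i j → ad j i) (hτ : Function.Injective τ)
    (hc : c ≠ 0) (hgen : ∀ i k l j : V, i ≠ k → l ≠ j →
      (τ l - τ i) * (τ l - τ k) + c * ((τ j - τ i) * (τ j - τ k)) = 0 →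
      (l = i ∧ j = k) ∨ (l = k ∧ j = i))
    {i k : V} (p q : V × V) (hik : i ≠ k) :
    LineAdj (graphMatroid ad τ c).E ⟨(i, Sum.inl p), graphMatroid_mem_ground ad τ c _⟩
      ⟨(k, Sum.inl q), graphMatroid_mem_ground ad τ c _⟩ ↔ ad i k := by
  simp only [LineAdj, relMap_indepPairSymbol, relMap_indepTripleSymbol]
  constructor
  · rintro ⟨-, ⟨⟨l, z⟩, hz⟩, h1, h2, h3⟩
    rcases z with z | j
    · exfalso
      simp only [graphVector, linearIndependent_momentPoint_pair_iff,
        linearIndependent_momentPoint_iff, not_not, mul_eq_zero, sub_eq_zero] at h1 h2 h3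
      have := hτ.ne hik
      grind
    · by_cases hlj : l ≠ j ∧ ad l j
      · simp only [graphVector, if_pos hlj, linearIndependent_momentPoint_add_iff, not_not,
          mul_eq_zero] at h3
        rcases h3 with h3 | h3
        · exact absurd (hτ (sub_eq_zero.1 h3)) hik.symm
        · rcases hgen i k l j hik hlj.1 (by simpa only [mul_eq_zero] using h3) with
            ⟨rfl, rfl⟩ | ⟨rfl, rfl⟩
          · exact hlj.2
          · exact hsymm _ _ hlj.2
      · have := h1.ne_zero 1
        simp [graphVector, if_neg hlj] at this
  · intro h
    have hne := hτ.ne hik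
    refine ⟨linearIndependent_momentPoint_pair_iff.2 hne,
      ⟨(i, Sum.inr k), graphMatroid_mem_ground ad τ c _⟩, ?_⟩
    simp only [graphVector, if_pos (And.intro hik h), linearIndependent_momentPoint_add_iff]
    refine ⟨linearIndependent_momentPoint_left hne hc, linearIndependent_momentPoint_right hne, ?_⟩
    ring_nf
    simp

theorem graphMatroid_eRank (hτ : Function.Injective τ) (e : Fin 3 → V)
    (he : Function.Injective e) : (graphMatroid ad τ c).eRank = 3 := by
  refine Matroid.ofVectors_eRank_eq (F := ℚ) (graphVector ad τ c) (k := 3) (by simp)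
    (fun i => (e i, Sum.inl (e i, e i))) ?_
  have h : graphVector ad τ c ∘ (fun i => (e i, Sum.inl (e i, e i))) =
      ![momentPoint (τ (e 0)), momentPoint (τ (e 1)), momentPoint (τ (e 2))] := by
    funext i
    fin_cases i <;> rfl
  rw [h, linearIndependent_momentPoint_iff]
  simp [sub_eq_zero, hτ.eq_iff, he.eq_iff]

end GraphMatroid

/-! ### Counting four-cycles -/

section Counting

variable {α : Type*} [Fintype α]

/-- The number of four-cycles weighted by a kernel. -/
def cycleSum (g : α → α → ℝ) : ℝ := ∑ a, ∑ a', (∑ b, g a b * g a' b) ^ 2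

/-- Functions on `Fin 4` as quadruples. -/
def finFourArrowEquiv (α : Type*) : (Fin 4 → α) ≃ α × α × α × α where
  toFun v := (v 0, v 1, v 2, v 3)
  invFun p := ![p.1, p.2.1, p.2.2.1, p.2.2.2]
  left_inv v := by ext i; fin_cases i <;> rfl
  right_inv _ := rfl

theorem sum_propSign_evenCycle (R : α → α → Prop) :
    ∑ v : Fin 4 → α, propSign (EvenCycle R v) = cycleSum fun a b => propSign (R a b) := by
  rw [← (finFourArrowEquiv α).symm.sum_comp]
  simp only [Fintype.sum_prod_type, cycleSum]
  refine Finset.sum_congr rfl fun a _ => Finset.sum_congr rfl fun a' _ => ?_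
  rw [sq, Finset.sum_mul_sum]
  exact Finset.sum_congr rfl fun b _ => Finset.sum_congr rfl fun b' _ => propSign_evenCycle R _

theorem sum_propSign {β : Type*} [Fintype β] (p : β → Prop) :
    ∑ x, propSign (p x) = 2 * (Nat.card {x // p x} : ℝ) - Nat.card β := by
  classical
  have h : ∀ x, propSign (p x) = 2 * (if p x then 1 else 0) - 1 := by
    intro x
    by_cases hx : p x <;> (simp [propSign, hx]; try norm_num)
  simp_rw [h]
  rw [Finset.sum_sub_distrib, ← Finset.mul_sum, Finset.sum_boole]
  simp [Fintype.card_subtype]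

/-- Inner products have size at most n, and changing the kernel moves the one at (a, a') by at most
`D a + D a'`. Factoring the difference of squares bounds each term by 2n(D a + D a'), and summing
over both indices gives the factor 4n². -/
theorem abs_cycleSum_sub_le {g h : α → α → ℝ} (hg : ∀ a b, |g a b| ≤ 1) (hh : ∀ a b, |h a b| ≤ 1) :
    |cycleSum g - cycleSum h| ≤ 4 * (Fintype.card α : ℝ) ^ 2 * ∑ a, ∑ b, |g a b - h a b| := by
  set n : ℝ := (Fintype.card α : ℝ)
  set D : α → ℝ := fun a => ∑ b, |g a b - h a b|
  have hbound : ∀ {f : α → α → ℝ}, (∀ a b, |f a b| ≤ 1) → ∀ a a', |∑ b, f a b * f a' b| ≤ n := by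
    intro f hf a a'
    refine (Finset.abs_sum_le_sum_abs _ _).trans ?_
    refine (Finset.sum_le_card_nsmul _ _ 1 fun b _ => ?_).trans (by simp [n])
    rw [abs_mul]
    exact mul_le_one₀ (hf _ _) (abs_nonneg _) (hf _ _)
  have hdiff : ∀ a a', |∑ b, g a b * g a' b - ∑ b, h a b * h a' b| ≤ D a + D a' := by
    intro a a'
    rw [← Finset.sum_sub_distrib, ← Finset.sum_add_distrib]
    refine (Finset.abs_sum_le_sum_abs _ _).trans (Finset.sum_le_sum fun b _ => ?_)
    have e : g a b * g a' b - h a b * h a' b =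
        (g a b - h a b) * g a' b + h a b * (g a' b - h a' b) := by ring
    rw [e]
    refine (abs_add_le _ _).trans (add_le_add ?_ ?_)
    · rw [abs_mul]; exact mul_le_of_le_one_right (abs_nonneg _) (hg _ _)
    · rw [abs_mul]; exact mul_le_of_le_one_left (abs_nonneg _) (hh _ _)
  have hterm : ∀ a a', |(∑ b, g a b * g a' b) ^ 2 - (∑ b, h a b * h a' b) ^ 2| ≤
      2 * n * (D a + D a') := by
    intro a a'
    rw [sq_sub_sq, abs_mul]
    refine mul_le_mul ((abs_add_le _ _).trans ?_) (hdiff a a') (abs_nonneg _) (by positivity)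
    linarith [hbound hg a a', hbound hh a a']
  have hsum : |cycleSum g - cycleSum h| ≤ ∑ a, ∑ a', 2 * n * (D a + D a') := by
    simp only [cycleSum, ← Finset.sum_sub_distrib]
    refine (Finset.abs_sum_le_sum_abs _ _).trans (Finset.sum_le_sum fun a _ => ?_)
    exact (Finset.abs_sum_le_sum_abs _ _).trans (Finset.sum_le_sum fun a' _ => hterm a a')
  refine hsum.trans_eq ?_
  simp only [← Finset.mul_sum, Finset.sum_add_distrib, Finset.sum_const, Finset.card_univ,
    nsmul_eq_mul]
  ring

end Counting

/-! ### The Hadamard graphs -/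

section Hadamard

/-- The Sylvester sign matrices. -/
def sylvesterSign {m : ℕ} (x y : Fin m → Bool) : ℝ := ∏ i, if x i && y i then -1 else 1

theorem sylvesterSign_comm {m : ℕ} (x y : Fin m → Bool) :
    sylvesterSign x y = sylvesterSign y x := by
  simp only [sylvesterSign, Bool.and_comm]

theorem sylvesterSign_eq_one_or {m : ℕ} (x y : Fin m → Bool) :
    sylvesterSign x y = 1 ∨ sylvesterSign x y = -1 := by
  refine Finset.prod_induction _ (fun r : ℝ => r = 1 ∨ r = -1) ?_ (Or.inl rfl) fun i _ => ?_
  · rintro a b (rfl | rfl) (rfl | rfl) <;> simp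
  · split_ifs <;> simp

/-- Two vertices are adjacent if the corresponding sign is positive. -/
def SylvesterAdj {m : ℕ} (x y : Fin m → Bool) : Prop := sylvesterSign x y = 1

theorem propSign_sylvesterAdj {m : ℕ} (x y : Fin m → Bool) :
    propSign (SylvesterAdj x y) = sylvesterSign x y := by
  rcases sylvesterSign_eq_one_or x y with h | h <;> simp [propSign, SylvesterAdj, h]
  norm_num

/-- The sum factors over coordinates; a coordinate where `x` and `x'` differ contributes 1 + (-1) =
0, and any other contributes 2. -/
theorem sum_sylvesterSign_mul {m : ℕ} (x x' : Fin m → Bool) :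
    ∑ y, sylvesterSign x y * sylvesterSign x' y = if x = x' then (2 : ℝ) ^ m else 0 := by
  simp only [sylvesterSign, ← Finset.prod_mul_distrib]
  have h := Finset.prod_univ_sum (fun _ : Fin m => (Finset.univ : Finset Bool))
    (fun i b => (if x i && b then (-1 : ℝ) else 1) * (if x' i && b then -1 else 1))
  rw [Fintype.piFinset_univ] at h
  rw [← h]
  have h2 : ∀ i, ∑ b, (if x i && b then (-1 : ℝ) else 1) * (if x' i && b then -1 else 1) =
      if x i = x' i then 2 else 0 := by
    intro i
    cases x i <;> cases x' i <;> norm_num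
  simp only [h2]
  split_ifs with hx
  · simp [hx]
  · obtain ⟨i, hi⟩ := Function.ne_iff.1 hx
    exact Finset.prod_eq_zero (Finset.mem_univ i) (if_neg hi)

/-- By orthogonality only pairs with equal first components survive: there are N|Z|² of them, each
contributing (|Z|N)², where N = 2^m. -/
theorem cycleSum_sylvesterSign_fst (m : ℕ) (Z : Type*) [Fintype Z] :
    cycleSum (fun a b : (Fin m → Bool) × Z => sylvesterSign a.1 b.1) =
      (Fintype.card Z : ℝ) ^ 4 * ((2 : ℝ) ^ m) ^ 3 := by
  simp only [cycleSum, Fintype.sum_prod_type, Finset.sum_const, Finset.card_univ, nsmul_eq_mul,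
    ← Finset.mul_sum, sum_sylvesterSign_mul, mul_pow]
  simp only [ite_pow, ne_eq, OfNat.ofNat_ne_zero,
    not_false_eq_true, zero_pow]
  simp
  ring

end Hadamard

/-! ### The matroids of the Hadamard graphs -/

section Final

/-- The elements of the matroid of the graph on `2 ^ m` vertices. -/
abbrev SylvesterElement (m : ℕ) : Type :=
  (Fin m → Bool) × (((Fin m → Bool) × (Fin m → Bool)) ⊕ (Fin m → Bool))

theorem exists_sylvesterMatroid (m : ℕ) (hm : 2 ≤ m) :
    ∃ M : Matroid (SylvesterElement m), M.E = Set.univ ∧ M.eRank = 3 ∧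
      M.IsRepresentableOver ℚ ∧ ∀ a b : M.E, (a : SylvesterElement m).2.isLeft →
        (b : SylvesterElement m).2.isLeft → (a : SylvesterElement m).1 ≠ (b : SylvesterElement m).1 →
        (LineAdj M.E a b ↔
          SylvesterAdj (a : SylvesterElement m).1 (b : SylvesterElement m).1) := by
  let τ : (Fin m → Bool) → ℚ := fun x => ((Fintype.equivFin (Fin m → Bool) x : ℕ) : ℚ)
  have hτ : Function.Injective τ := fun x y h => by
    simpa [τ, Fin.val_inj] using h
  obtain ⟨c, hc, hgen⟩ := exists_generic_ratio τ hτ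
  refine ⟨graphMatroid SylvesterAdj τ c, rfl, ?_, ⟨3, graphVector SylvesterAdj τ c,
    fun I _ => Iff.rfl⟩, ?_⟩
  · have hcard : Fintype.card (Fin 3) ≤ Fintype.card (Fin m → Bool) := by
      have := Nat.pow_le_pow_right (n := 2) (by norm_num) hm
      simp
      omega
    obtain ⟨e⟩ := Function.Embedding.nonempty_of_card_le hcard
    exact graphMatroid_eRank hτ e e.injective
  · rintro ⟨⟨i, p | p⟩, _⟩ ⟨⟨k, q | q⟩, _⟩ ha hb hik
    · exact lineAdj_graphMatroid_iff (fun x y h => by rwa [SylvesterAdj, sylvesterSign_comm])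
        hτ hc hgen p q hik
    all_goals simp at ha hb

theorem sum_sum_fst {V Z : Type*} [Fintype V] [Fintype Z] (f : V → V → ℝ) :
    ∑ a : V × Z, ∑ b : V × Z, f a.1 b.1 = (Fintype.card Z : ℝ) ^ 2 * ∑ x, ∑ y, f x y := by
  simp only [Fintype.sum_prod_type, Finset.sum_const, Finset.card_univ, nsmul_eq_mul,
    ← Finset.mul_sum]
  ring

theorem sum_isRight {V Y Z : Type*} [Fintype V] [Fintype Y] [Fintype Z] :
    ∑ a : V × (Y ⊕ Z), (if a.2.isRight then (1 : ℝ) else 0) =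
      (Fintype.card V : ℝ) * Fintype.card Z := by
  rw [Fintype.sum_prod_type]
  simp only [Fintype.sum_sum_type]
  simp

/-- The signs of adjacency and the Sylvester signs differ only for few pairs. -/
theorem sum_abs_propSign_sub_le {m : ℕ} (R : SylvesterElement m → SylvesterElement m → Prop)
    (hR : ∀ a b, a.2.isLeft → b.2.isLeft → a.1 ≠ b.1 → (R a b ↔ SylvesterAdj a.1 b.1)) :
    ∑ a, ∑ b, |propSign (R a b) - sylvesterSign a.1 b.1| ≤
      6 / (2 : ℝ) ^ m * (Fintype.card (SylvesterElement m) : ℝ) ^ 2 := by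
  -- With N = 2^m, a given entry is of chord type for a fraction 1/(N+1) of the pairs, and the
  -- vertices coincide for a fraction 1/N. Each exception costs at most 2, and 2(2/(N+1) + 1/N) ≤
  -- 6/N.
  have hterm : ∀ a b, |propSign (R a b) - sylvesterSign a.1 b.1| ≤
      2 * ((if a.2.isRight then 1 else 0) + (if b.2.isRight then 1 else 0) +
        (if a.1 = b.1 then 1 else 0)) := by
    intro a b
    have htriv : |propSign (R a b) - sylvesterSign a.1 b.1| ≤ 2 := by
      rw [← propSign_sylvesterAdj]
      refine (abs_sub _ _).trans ?_
      rw [abs_propSign, abs_propSign]; norm_num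
    by_cases ha : a.2.isRight
    · rw [if_pos ha]
      split_ifs <;> linarith
    by_cases hb : b.2.isRight
    · rw [if_pos hb]; split_ifs <;> linarith
    by_cases hab : a.1 = b.1
    · rw [if_pos hab]; split_ifs <;> linarith
    rw [show propSign (R a b) = sylvesterSign a.1 b.1 by
      rw [← propSign_sylvesterAdj, hR a b (by simpa using ha) (by simpa using hb) hab]]
    simp [ha, hb, hab]
  refine (Finset.sum_le_sum fun a _ => Finset.sum_le_sum fun b _ => hterm a b).trans ?_
  simp only [← Finset.mul_sum, Finset.sum_add_distrib, Finset.sum_const, Finset.card_univ,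
    nsmul_eq_mul]
  rw [sum_sum_fst fun x y => if x = y then (1 : ℝ) else 0, sum_isRight]
  have hN : (0 : ℝ) < 2 ^ m := by positivity
  simp only [Finset.sum_ite_eq, Finset.mem_univ, if_true, Finset.sum_const, Finset.card_univ,
    nsmul_eq_mul, mul_one, Fintype.card_prod, Fintype.card_sum, Fintype.card_fun, Fintype.card_bool,
    Fintype.card_fin]
  push_cast
  generalize (2 : ℝ) ^ m = N at hN
  rw [div_mul_eq_mul_div, le_div_iff₀ hN]
  ring_nf
  nlinarith [pow_pos hN 5, pow_pos hN 6, pow_pos hN 4]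

theorem abs_finiteStonePairing_evenCycleFormula_le {m : ℕ} {M : Matroid (SylvesterElement m)}
    (hE : M.E = Set.univ) (hM : ∀ a b : M.E, (a : SylvesterElement m).2.isLeft →
        (b : SylvesterElement m).2.isLeft → (a : SylvesterElement m).1 ≠ (b : SylvesterElement m).1 →
        (LineAdj M.E a b ↔
          SylvesterAdj (a : SylvesterElement m).1 (b : SylvesterElement m).1)) :
    |finiteStonePairing M.E evenCycleFormula - 1 / 2| ≤ 25 / 2 * (1 / 2) ^ m := by
  let e : SylvesterElement m ≃ M.E :=
    ⟨fun a => ⟨a, hE ▸ Set.mem_univ a⟩, Subtype.val, fun _ => rfl, fun _ => rfl⟩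
  let R : SylvesterElement m → SylvesterElement m → Prop := fun a b => LineAdj M.E (e a) (e b)
  have hcardE : Nat.card M.E = Fintype.card (SylvesterElement m) := by
    rw [← Nat.card_congr e, Nat.card_eq_fintype_card]
  have hcard : Nat.card {v : Fin 4 → M.E // evenCycleFormula.Realize v} =
      Nat.card {v : Fin 4 → SylvesterElement m // EvenCycle R v} := by
    refine (Nat.card_congr ((Equiv.arrowCongr (Equiv.refl (Fin 4)) e).subtypeEquiv fun v => ?_)).symm
    rw [realize_evenCycleFormula]
    rfl
  set n : ℝ := (Fintype.card (SylvesterElement m) : ℝ) with hn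
  have hnpos : 0 < n := by
    rw [hn]; exact_mod_cast Fintype.card_pos
  have h1 := sum_propSign fun v : Fin 4 → SylvesterElement m => EvenCycle R v
  rw [sum_propSign_evenCycle] at h1
  have h2 := abs_cycleSum_sub_le (g := fun a b => propSign (R a b))
    (h := fun a b : SylvesterElement m => sylvesterSign a.1 b.1)
    (fun a b => (abs_propSign _).le)
    (fun a b => by rw [← propSign_sylvesterAdj]; exact (abs_propSign _).le)
  have h3 := sum_abs_propSign_sub_le R fun a b => hM (e a) (e b)
  rw [cycleSum_sylvesterSign_fst] at h2
  have hN : (0 : ℝ) < 2 ^ m := by positivity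
  have h4 : (Fintype.card (((Fin m → Bool) × (Fin m → Bool)) ⊕ (Fin m → Bool)) : ℝ) ^ 4 *
      ((2 : ℝ) ^ m) ^ 3 = n ^ 4 / 2 ^ m := by
    rw [hn, Fintype.card_prod]
    field_simp
    simp
    ring
  have h5 : (Nat.card (Fin 4 → SylvesterElement m) : ℝ) = n ^ 4 := by
    simp [hn]
  rw [h4] at h2
  rw [h5] at h1
  -- The Sylvester kernel contributes 1 to the constant 25 and the perturbation 4 · 6 = 24. A
  -- proportion p of even cycles has mean sign 2p - 1, so the distance of p from 1/2 is half of the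
  -- mean, whence 25/2.
  have h6 : |cycleSum fun a b => propSign (R a b)| ≤ 25 / 2 ^ m * n ^ 4 := by
    have h7 := mul_le_mul_of_nonneg_left h3 (by positivity : 0 ≤ 4 * n ^ 2)
    have h8 := abs_sub_abs_le_abs_sub (cycleSum fun a b => propSign (R a b)) (n ^ 4 / 2 ^ m)
    rw [abs_of_pos (by positivity : 0 < n ^ 4 / 2 ^ m)] at h8
    calc _ ≤ n ^ 4 / 2 ^ m + 4 * n ^ 2 * (6 / 2 ^ m * n ^ 2) := by linarith
      _ = _ := by ring
  have h9 : finiteStonePairing M.E evenCycleFormula - 1 / 2 =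
      (cycleSum fun a b => propSign (R a b)) / (2 * n ^ 4) := by
    rw [finiteStonePairing, hcard, hcardE, ← hn, h1]
    field_simp
  rw [h9, abs_div, abs_of_pos (by positivity : 0 < 2 * n ^ 4), div_le_iff₀ (by positivity)]
  refine h6.trans_eq ?_
  rw [one_div, inv_pow]
  field_simp

end Final

theorem theoremt :
    ∃ (α : ℕ → Type) (M : ∀ n, Matroid (α n)),
      (∀ n, (M n).Finite ∧ (M n).eRank = 3 ∧ (M n).IsRepresentableOver ℚ) ∧
      FOConvergent matroidLanguage (fun n => (M n).E) ∧
      ¬ ∃ A : FOModeling.{u} matroidLanguage, A.IsMatroidLimitModeling M := by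
  -- The shift by 2 ensures at least three vertices, as rank three requires.
  choose M hE hrank hrep hadj using fun n : ℕ => exists_sylvesterMatroid (n + 2) (by omega)
  obtain ⟨s, hs, hconv⟩ := exists_foConvergent_subseq (L := matroidLanguage) fun n => (M n).E
  refine ⟨fun n => SylvesterElement (s n + 2), fun n => M (s n),
    fun n => ⟨⟨Set.toFinite _⟩, hrank _, hrep _⟩, hconv, ?_⟩
  rintro ⟨A, -, hA⟩
  refine A.stonePairing_evenCycleFormula_ne_half
    (tendsto_nhds_unique (hA 4 evenCycleFormula) ?_)
  have hlim : Tendsto (fun n => finiteStonePairing (M n).E evenCycleFormula) atTop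
      (𝓝 (1 / 2)) := by
    rw [tendsto_iff_dist_tendsto_zero]
    refine squeeze_zero (fun _ => dist_nonneg)
      (fun n => abs_finiteStonePairing_evenCycleFormula_le (hE n) (hadj n)) ?_
    have h := (tendsto_pow_atTop_nhds_zero_of_lt_one (r := (1 / 2 : ℝ)) (by norm_num)
      (by norm_num)).comp (tendsto_add_atTop_nat 2)
    simpa using h.const_mul (25 / 2)
  exact hlim.comp hs.tendsto_atTop
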